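/- **Theorem 1.3.** Let $\mathcal{F}, \mathcal{E}$ be complex Hilbert spaces. For a Hilbert space $\mathcal{H}$, let $H^2_{\mathcal{H}}(\mathbb{D})$ be the Hardy space of analytic functions $f(z)=\sum_{k\ge 0} a_k z^k$ on the open unit disc $\mathbb{D}$ with $a_k\in\mathcal{H}$ and $\|f\|^2=\sum_k\|a_k\|^2<\infty$; it is identified with a closed subspace of $L^2_{\mathcal{H}}(\mathbb{T})$ ($\mathbb{T}$ the unit circle with normalized Lebesgue measure) through $f\mapsto\sum_k a_k e^{ik\theta}$. A bounded operator $T$ on $H^2_{\mathcal{E}}(\mathbb{D})$ is called *Toeplitz* if there is $\Phi\in L^\infty_{\mathcal{B}(\mathcal{E})}(\mathbb{T})$ (an essentially bounded function $\Phi:\mathbb{T}\to\mathcal{B}(\mathcal{E})$ such that $\Phi(\cdot)x$ is strongly measurable for every $x\in\mathcal{E}$) with $T=P_{H^2_{\mathcal{E}}(\mathbb{D})}L_\Phi|_{H^2_{\mathcal{E}}(\mathbb{D})}$, where $L_\Phi$ is multiplication by $\Phi$ on $L^2_{\mathcal{E}}(\mathbb{T})$ and $P_{H^2_{\mathcal{E}}(\mathbb{D})}$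 is the orthogonal projection of $L^2_{\mathcal{E}}(\mathbb{T})$ onto $H^2_{\mathcal{E}}(\mathbb{D})$. Let $\Gamma,\Psi:\mathbb{D}\to\mathcal{B}(\mathcal{F},\mathcal{E})$ be bounded analytic functions, and let $M_\Gamma, M_\Psi: H^2_{\mathcal{F}}(\mathbb{D})\to H^2_{\mathcal{E}}(\mathbb{D})$ be the multiplication operators $(M_\Gamma f)(z)=\Gamma(z)f(z)$, $(M_\Psi f)(z)=\Psi(z)f(z)$. Then the following are equivalent: 1. $M_\Gamma M_\Psi^*$ is a Toeplitz operator on $H^2_{\mathcal{E}}(\mathbb{D})$; 2. $(\Gamma(\lambda)-\Gamma(0))(\Psi(\mu)-\Psi(0))^*=0$ for all $\lambda,\mu\in\mathbb{D}$; 3. $M_\Gamma M_\Psi^* = M_\Gamma\Psi(0)^*+\Gamma(0)M_\Psi^*-\Gamma(0)\Psi(0)^*$, where in 3 a bounded operator between $\mathcal{E}$ and $\mathcal{F}$, or on $\mathcal{E}$, acts pointwise on Hardy space functions, $(Af)(z)=A(f(z))$. -/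

import Mathlib

noncomputable section

open MeasureTheory AddCircle

namespace HardyToeplitz

/-- The `E`-valued Hardy space `H²_E(𝔻)`: the power series `∑ aₖ zᵏ` with coefficients in the Hilbert
space `E` such that `∑ ‖aₖ‖² < ∞`, with the norm `(∑ ‖aₖ‖²)^(1/2)`. An element is stored as its
sequence of Taylor coefficients; the function on the disc which it represents is `toFun`. -/
abbrev Hardy (E : Type*) [NormedAddCommGroup E] [InnerProductSpace ℂ E] : Type _ :=
  lp (fun _ : ℕ => E) 2

/-- `L²_E(𝕋)`. The circle is `ℝ / ℤ` with its normalized Lebesgue measure, the point `t` standing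
for `e^{2πit}`; the function `t ↦ e^{2πikt}` is Mathlib's `fourier k`. -/
abbrev LTwo (E : Type*) [NormedAddCommGroup E] [InnerProductSpace ℂ E] : Type _ :=
  Lp E 2 (haarAddCircle : Measure UnitAddCircle)

variable {E F : Type*} [NormedAddCommGroup E] [InnerProductSpace ℂ E]
  [NormedAddCommGroup F] [InnerProductSpace ℂ F]

/-- The analytic function `z ↦ ∑ aₖ zᵏ` on the unit disc represented by `f ∈ H²_E(𝔻)`. -/
def Hardy.toFun (f : Hardy E) (z : ℂ) : E := ∑' k : ℕ, z ^ k • f k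

/-! ### The boundary map `H²_E(𝔻) → L²_E(𝕋)` -/

/-- The continuous function `t ↦ e^{2πikt} x` on the circle. -/
def monoC (k : ℕ) (x : E) : C(UnitAddCircle, E) :=
  ⟨fun t => fourier (k : ℤ) t • x, by fun_prop⟩

lemma norm_monoC_apply (k : ℕ) (x : E) (t : UnitAddCircle) : ‖monoC k x t‖ = ‖x‖ := by
  have h : ‖fourier (T := (1 : ℝ)) (k : ℤ) t‖ = 1 := Circle.norm_coe _
  rw [monoC, ContinuousMap.coe_mk, norm_smul, h, one_mul]

lemma coe_toLp (f : C(UnitAddCircle, E)) :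
    (ContinuousMap.toLp 2 haarAddCircle ℂ f : LTwo E) =ᵐ[haarAddCircle] f :=
  ContinuousMap.coeFn_toLp _ _

lemma norm_toLp_monoC (k : ℕ) (x : E) :
    ‖(ContinuousMap.toLp 2 haarAddCircle ℂ (monoC k x) : LTwo E)‖ = ‖x‖ := by
  have h : eLpNorm (ContinuousMap.toLp 2 haarAddCircle ℂ (monoC k x) : LTwo E) 2 haarAddCircle
      = eLpNorm (fun _ : UnitAddCircle => x) 2 haarAddCircle := by
    apply eLpNorm_congr_norm_ae
    filter_upwards [coe_toLp (monoC k x)] with t ht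
    rw [ht, norm_monoC_apply]
  rw [Lp.norm_def, h, eLpNorm_const _ (by norm_num) (NeZero.ne _)]
  simp

/-- The embedding `x ↦ e^{2πikt} x` of `E` into `L²_E(𝕋)`. -/
def mono (E : Type*) [NormedAddCommGroup E] [InnerProductSpace ℂ E] (k : ℕ) :
    E →ₗᵢ[ℂ] LTwo E where
  toFun x := ContinuousMap.toLp 2 haarAddCircle ℂ (monoC k x)
  map_add' x y := by
    rw [← map_add]; congr 1; ext t; simp [monoC]
  map_smul' c x := by
    rw [RingHom.id_apply, ← map_smul]; congr 1; ext t
    exact smul_comm _ _ _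
  norm_map' x := norm_toLp_monoC k x

lemma orthogonalFamily_mono : OrthogonalFamily ℂ (fun _ : ℕ => E) (mono E) := by
  intro m n hmn x y
  have h0 := orthonormal_fourier (T := (1 : ℝ)).2 (i := (m : ℤ)) (j := (n : ℤ))
    (by exact_mod_cast hmn)
  beta_reduce at h0
  rw [L2.inner_def] at h0 ⊢
  have e : ∀ᵐ t ∂(haarAddCircle : Measure UnitAddCircle),
      inner ℂ ((mono E m x : LTwo E) t) ((mono E n y : LTwo E) t)
        = inner ℂ ((fourierLp (T := (1 : ℝ)) 2 (m : ℤ)) t) ((fourierLp (T := (1 : ℝ)) 2 (n : ℤ)) t)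
          * inner ℂ x y := by
    filter_upwards [coe_toLp (monoC m x), coe_toLp (monoC n y),
      coeFn_fourierLp (T := (1 : ℝ)) 2 (m : ℤ), coeFn_fourierLp (T := (1 : ℝ)) 2 (n : ℤ)]
      with t h1 h2 h3 h4
    rw [h3, h4]
    change inner ℂ ((ContinuousMap.toLp 2 haarAddCircle ℂ (monoC m x) : LTwo E) t)
      ((ContinuousMap.toLp 2 haarAddCircle ℂ (monoC n y) : LTwo E) t) = _
    rw [h1, h2]
    simp only [monoC, ContinuousMap.coe_mk, inner_smul_left, inner_smul_right]
    simp
    ring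
  rw [integral_congr_ae e, integral_mul_const, h0, zero_mul]

/-- The identification of `H²_E(𝔻)` with a closed subspace of `L²_E(𝕋)`:
`∑ aₖ zᵏ` is sent to its boundary function `∑ aₖ e^{2πikt}` (convergence in `L²_E(𝕋)`). -/
def boundary (E : Type*) [NormedAddCommGroup E] [InnerProductSpace ℂ E] [CompleteSpace E] :
    Hardy E →ₗᵢ[ℂ] LTwo E :=
  (orthogonalFamily_mono (E := E)).linearIsometry

/-- The Hardy space `H²_E(𝕋)` as a closed subspace of `L²_E(𝕋)`. -/
def hardyTorus (E : Type*) [NormedAddCommGroup E] [InnerProductSpace ℂ E] [CompleteSpace E] :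
    Submodule ℂ (LTwo E) :=
  LinearMap.range (boundary E).toLinearMap

instance [CompleteSpace E] : CompleteSpace (hardyTorus E) := by
  have h : IsComplete ((hardyTorus E : Submodule ℂ (LTwo E)) : Set (LTwo E)) := by
    rw [hardyTorus, LinearMap.coe_range]
    exact (boundary E).isometry.isUniformInducing.isComplete_range
  exact h.completeSpace_coe

/-! ### Toeplitz operators -/

/-- `Φ ∈ L^∞_{B(E)}(𝕋)`: strongly measurable (`t ↦ Φ(t) x` is measurable for every `x ∈ E`) and
essentially bounded. -/
structure IsSymbol (Φ : UnitAddCircle → E →L[ℂ] E) : Prop where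
  meas : ∀ x : E, AEStronglyMeasurable (fun t => Φ t x) haarAddCircle
  bdd : ∃ C : ℝ, ∀ᵐ t ∂(haarAddCircle : Measure UnitAddCircle), ‖Φ t‖ ≤ C

lemma IsSymbol.aesm_simple {Φ : UnitAddCircle → E →L[ℂ] E} (h : IsSymbol Φ)
    (s : SimpleFunc UnitAddCircle E) :
    AEStronglyMeasurable (fun t => Φ t (s t)) haarAddCircle := by
  classical
  induction s using SimpleFunc.induction with
  | const c hs =>
    rename_i A
    have e : (fun t => Φ t ((SimpleFunc.piecewise A hs (SimpleFunc.const _ c)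
        (SimpleFunc.const _ 0)) t)) = A.indicator (fun t => Φ t c) := by
      ext t
      by_cases ht : t ∈ A <;> simp [ht]
    rw [e]
    exact (h.meas c).indicator hs
  | add hd hf hg =>
    simp only [SimpleFunc.coe_add, Pi.add_apply, map_add]
    exact hf.add hg

lemma IsSymbol.aesm {Φ : UnitAddCircle → E →L[ℂ] E} (h : IsSymbol Φ) {f : UnitAddCircle → E}
    (hf : AEStronglyMeasurable f haarAddCircle) :
    AEStronglyMeasurable (fun t => Φ t (f t)) haarAddCircle := by
  refine aestronglyMeasurable_of_tendsto_ae Filter.atTop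
    (f := fun n t => Φ t (hf.stronglyMeasurable_mk.approx n t))
    (fun n => h.aesm_simple _) ?_
  filter_upwards [hf.ae_eq_mk] with t ht
  rw [ht]
  exact ((Φ t).continuous.tendsto _).comp (hf.stronglyMeasurable_mk.tendsto_approx t)

/-- An essential bound of a symbol. -/
def IsSymbol.bound {Φ : UnitAddCircle → E →L[ℂ] E} (h : IsSymbol Φ) : ℝ := h.bdd.choose

lemma IsSymbol.ae_le {Φ : UnitAddCircle → E →L[ℂ] E} (h : IsSymbol Φ) (f : UnitAddCircle → E) :
    ∀ᵐ t ∂(haarAddCircle : Measure UnitAddCircle), ‖Φ t (f t)‖ ≤ h.bound * ‖f t‖ := by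
  filter_upwards [h.bdd.choose_spec] with t ht
  exact (Φ t).le_of_opNorm_le ht _

lemma IsSymbol.memLp {Φ : UnitAddCircle → E →L[ℂ] E} (h : IsSymbol Φ) (f : LTwo E) :
    MemLp (fun t => Φ t (f t)) 2 (haarAddCircle : Measure UnitAddCircle) :=
  (Lp.memLp f).of_le_mul (h.aesm (Lp.aestronglyMeasurable f)) (h.ae_le f)

/-- The Laurent operator `L_Φ` on `L²_E(𝕋)`: `(L_Φ f)(t) = Φ(t) f(t)` for almost every `t`. -/
def laurent (Φ : UnitAddCircle → E →L[ℂ] E) (h : IsSymbol Φ) : LTwo E →L[ℂ] LTwo E :=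
  LinearMap.mkContinuous
    { toFun := fun f => (h.memLp f).toLp (fun t => Φ t (f t))
      map_add' := by
        intro f g
        rw [← MemLp.toLp_add, MemLp.toLp_eq_toLp_iff]
        filter_upwards [Lp.coeFn_add f g] with t ht
        rw [ht, Pi.add_apply, map_add, Pi.add_apply]
      map_smul' := by
        intro c f
        rw [RingHom.id_apply, ← MemLp.toLp_const_smul, MemLp.toLp_eq_toLp_iff]
        filter_upwards [Lp.coeFn_smul c f] with t ht
        rw [ht, Pi.smul_apply, map_smul, Pi.smul_apply] }
    h.bound
    (by
      intro f
      apply Lp.norm_le_mul_norm_of_ae_le_mul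
      filter_upwards [(h.memLp f).coeFn_toLp, h.ae_le f] with t h1 h2
      simpa [h1] using h2)

/-- A bounded operator `T` on `H²_E(𝔻)` is Toeplitz if, under the identification of `H²_E(𝔻)` with
`H²_E(𝕋)`, it is the compression `P_{H²_E} L_Φ |_{H²_E}` of a Laurent operator with symbol
`Φ ∈ L^∞_{B(E)}(𝕋)`. -/
def IsToeplitz [CompleteSpace E] (T : Hardy E →L[ℂ] Hardy E) : Prop :=
  ∃ (Φ : UnitAddCircle → E →L[ℂ] E) (hΦ : IsSymbol Φ), ∀ f : Hardy E,
    boundary E (T f) = (hardyTorus E).starProjection (laurent Φ hΦ (boundary E f))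

/-! ### Multiplication operators -/

/-- `Γ ∈ H^∞_{B(F,E)}(𝔻)`: `Γ` is analytic and bounded on the open unit disc (only the values of
`Γ` on the disc matter). -/
structure IsBoundedAnalytic (Γ : ℂ → F →L[ℂ] E) : Prop where
  diff : DifferentiableOn ℂ Γ (Metric.ball 0 1)
  bdd : ∃ C : ℝ, ∀ z ∈ Metric.ball (0 : ℂ) 1, ‖Γ z‖ ≤ C

lemma isBoundedAnalytic_const (A : F →L[ℂ] E) : IsBoundedAnalytic (fun _ => A) :=
  ⟨differentiableOn_const _, ‖A‖, fun _ _ => le_rfl⟩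

/-- The `n`-th Taylor coefficient at `0` of a function on the disc. -/
def taylorCoeff (g : ℂ → E) (n : ℕ) : E := ((n.factorial : ℂ))⁻¹ • iteratedDeriv n g 0

section Multiplication

set_option linter.unusedSectionVars false

variable [CompleteSpace E] [CompleteSpace F]

lemma summable_toFun (f : Hardy E) {z : ℂ} (hz : ‖z‖ < 1) : Summable fun k => ‖z ^ k • f k‖ := by
  refine Summable.of_nonneg_of_le (fun _ => norm_nonneg _) (fun k => ?_)
    ((summable_geometric_of_lt_one (norm_nonneg z) hz).mul_right ‖f‖)
  rw [norm_smul, norm_pow]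
  exact mul_le_mul_of_nonneg_left (lp.norm_apply_le_norm (by norm_num) f k) (by positivity)

lemma differentiableOn_toFun (f : Hardy E) : DifferentiableOn ℂ f.toFun (Metric.ball 0 1) := by
  intro z hz
  rw [mem_ball_zero_iff] at hz
  obtain ⟨r, hzr, hr1⟩ := exists_between hz
  have hr0 : 0 ≤ r := (norm_nonneg z).trans hzr.le
  have h : DifferentiableOn ℂ f.toFun (Metric.ball 0 r) := by
    refine Complex.differentiableOn_tsum_of_summable_norm
      (u := fun k => r ^ k * ‖f‖) ((summable_geometric_of_lt_one hr0 hr1).mul_right _)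
      (fun k => by fun_prop) Metric.isOpen_ball ?_
    intro k w hw
    rw [mem_ball_zero_iff] at hw
    rw [norm_smul, norm_pow]
    exact mul_le_mul (pow_le_pow_left₀ (norm_nonneg _) hw.le _)
      (lp.norm_apply_le_norm (by norm_num) f k) (norm_nonneg _) (by positivity)
  exact ((h z (mem_ball_zero_iff.2 hzr)).differentiableAt
    (Metric.isOpen_ball.mem_nhds (mem_ball_zero_iff.2 hzr))).differentiableWithinAt

lemma fourier_natCast (k : ℕ) (t : UnitAddCircle) :
    fourier (k : ℤ) t = fourier (1 : ℤ) t ^ k := by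
  rw [fourier_apply, fourier_one, toCircle_zsmul]; simp

/-- For absolutely summable coefficients the boundary function is given by the series itself. -/
lemma boundary_ae (x : Hardy E) (hx : Summable fun k => ‖x k‖) :
    boundary E x =ᵐ[haarAddCircle] fun t => x.toFun (fourier (1 : ℤ) t) := by
  have hs : Summable fun k => monoC k (x k) := by
    refine Summable.of_norm_bounded hx fun k => ?_
    rw [ContinuousMap.norm_le _ (norm_nonneg _)]
    exact fun t => (norm_monoC_apply k (x k) t).le
  have h1 := hs.hasSum.mapL (ContinuousMap.toLp (E := E) 2
    (haarAddCircle : Measure UnitAddCircle) ℂ)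
  have h2 := (orthogonalFamily_mono (E := E)).hasSum_linearIsometry x
  have h3 : boundary E x = ContinuousMap.toLp 2 haarAddCircle ℂ (∑' k, monoC k (x k)) :=
    h2.unique h1
  rw [h3]
  filter_upwards [coe_toLp (∑' k, monoC k (x k))] with t ht
  rw [ht, ← ContinuousMap.tsum_apply hs, Hardy.toFun]
  exact tsum_congr fun k => by rw [monoC, ContinuousMap.coe_mk, fourier_natCast]

lemma norm_le_of_boundary_le (x : Hardy F) (y : Hardy E) (hx : Summable fun k => ‖x k‖)
    (hy : Summable fun k => ‖y k‖) (C : ℝ)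
    (h : ∀ w : ℂ, ‖w‖ = 1 → ‖y.toFun w‖ ≤ C * ‖x.toFun w‖) : ‖y‖ ≤ C * ‖x‖ := by
  rw [← (boundary E).norm_map y, ← (boundary F).norm_map x]
  apply Lp.norm_le_mul_norm_of_ae_le_mul
  filter_upwards [boundary_ae x hx, boundary_ae y hy] with t h1 h2
  rw [h1, h2]
  exact h _ (Circle.norm_coe _)

/-- A sequence with absolutely summable terms, as an element of the Hardy space. -/
def ofSummable (a : ℕ → E) (ha : Summable fun k => ‖a k‖) : Hardy E :=
  ⟨a, (memℓp_gen (p := 1) (by simpa using ha)).of_exponent_ge (by norm_num)⟩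

lemma hasSum_taylorCoeff {g : ℂ → E} (hg : DifferentiableOn ℂ g (Metric.ball 0 1)) {z : ℂ}
    (hz : ‖z‖ < 1) : HasSum (fun n => z ^ n • taylorCoeff g n) (g z) := by
  have h := Complex.hasSum_taylorSeries_on_ball hg (mem_ball_zero_iff.2 hz)
  simp only [sub_zero] at h
  convert h using 2 with n
  rw [taylorCoeff, smul_comm]

lemma summable_taylorCoeff {g : ℂ → E} (hg : DifferentiableOn ℂ g (Metric.ball 0 1)) {r : ℝ}
    (hr0 : 0 ≤ r) (hr : r < 1) : Summable fun n => ‖(r : ℂ) ^ n • taylorCoeff g n‖ := by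
  obtain ⟨R, hrR, hR⟩ := exists_between hr
  have hR0 : 0 < R := hr0.trans_lt hrR
  have h := (hasSum_taylorCoeff hg (z := (R : ℂ))
    (by rwa [Complex.norm_real, Real.norm_of_nonneg hR0.le])).summable.tendsto_atTop_zero
  obtain ⟨B, hB⟩ := (Metric.isBounded_range_of_tendsto _ h).exists_norm_le
  refine Summable.of_nonneg_of_le (fun _ => norm_nonneg _) (fun n => ?_)
    ((summable_geometric_of_lt_one (div_nonneg hr0 hR0.le)
      ((div_lt_one hR0).2 hrR)).mul_right B)
  have hn := hB _ ⟨n, rfl⟩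
  rw [norm_smul, norm_pow, Complex.norm_real, Real.norm_of_nonneg hR0.le] at hn
  rw [norm_smul, norm_pow, Complex.norm_real, Real.norm_of_nonneg hr0, div_pow, div_mul_eq_mul_div,
    le_div_iff₀ (by positivity)]
  calc r ^ n * ‖taylorCoeff g n‖ * R ^ n = r ^ n * (R ^ n * ‖taylorCoeff g n‖) := by ring
    _ ≤ r ^ n * B := by gcongr

lemma IsBoundedAnalytic.diff_mul {Γ : ℂ → F →L[ℂ] E} (h : IsBoundedAnalytic Γ) (f : Hardy F) :
    DifferentiableOn ℂ (fun z => Γ z (f.toFun z)) (Metric.ball 0 1) :=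
  h.diff.clm_apply (differentiableOn_toFun f)

/-- A bound of `Γ` on the disc. -/
def IsBoundedAnalytic.bound {Γ : ℂ → F →L[ℂ] E} (h : IsBoundedAnalytic Γ) : ℝ := h.bdd.choose

lemma IsBoundedAnalytic.norm_le {Γ : ℂ → F →L[ℂ] E} (h : IsBoundedAnalytic Γ) {z : ℂ}
    (hz : ‖z‖ < 1) : ‖Γ z‖ ≤ h.bound :=
  h.bdd.choose_spec z (mem_ball_zero_iff.2 hz)

lemma IsBoundedAnalytic.bound_nonneg {Γ : ℂ → F →L[ℂ] E} (h : IsBoundedAnalytic Γ) :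
    0 ≤ h.bound :=
  (norm_nonneg _).trans (h.norm_le (z := 0) (by simp))

lemma IsBoundedAnalytic.dilate {Γ : ℂ → F →L[ℂ] E} (h : IsBoundedAnalytic Γ) (f : Hardy F)
    {r : ℝ} (hr0 : 0 ≤ r) (hr : r < 1) :
    ‖ofSummable _ (summable_taylorCoeff (h.diff_mul f) hr0 hr)‖ ≤ h.bound * ‖f‖ := by
  have hrn : ‖(r : ℂ)‖ = r := by rw [Complex.norm_real, Real.norm_of_nonneg hr0]
  have hx := summable_toFun f (z := (r : ℂ)) (by rwa [hrn])
  have key := norm_le_of_boundary_le (ofSummable _ hx)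
    (ofSummable _ (summable_taylorCoeff (h.diff_mul f) hr0 hr)) hx
    (summable_taylorCoeff (h.diff_mul f) hr0 hr) h.bound ?_
  · refine key.trans (mul_le_mul_of_nonneg_left ?_ h.bound_nonneg)
    refine lp.norm_mono (by norm_num) fun k => ?_
    change ‖(r : ℂ) ^ k • f k‖ ≤ ‖f k‖
    rw [norm_smul, norm_pow, hrn]
    exact mul_le_of_le_one_left (norm_nonneg _) (pow_le_one₀ hr0 hr.le)
  · intro w hw
    have hrw : ‖(r : ℂ) * w‖ < 1 := by rwa [norm_mul, hw, mul_one, hrn]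
    have e1 : (ofSummable _ hx).toFun w = f.toFun (r * w) := by
      refine tsum_congr fun k => ?_
      change w ^ k • ((r : ℂ) ^ k • f k) = _
      rw [smul_smul, mul_pow, mul_comm]
    have e2 : (ofSummable _ (summable_taylorCoeff (h.diff_mul f) hr0 hr)).toFun w
        = Γ (r * w) (f.toFun (r * w)) := by
      rw [← (hasSum_taylorCoeff (h.diff_mul f) hrw).tsum_eq]
      refine tsum_congr fun k => ?_
      change w ^ k • ((r : ℂ) ^ k • _) = _
      rw [smul_smul, mul_pow, mul_comm]
    rw [e1, e2]
    exact (Γ _).le_of_opNorm_le (h.norm_le hrw) _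

lemma tendsto_radius : Filter.Tendsto (fun n : ℕ => 1 - 1 / ((n : ℝ) + 1)) Filter.atTop (nhds 1) := by
  simpa using (tendsto_const_nhds (x := (1 : ℝ))).sub tendsto_one_div_add_atTop_nhds_zero_nat

lemma radius_nonneg (n : ℕ) : 0 ≤ 1 - 1 / ((n : ℝ) + 1) := by
  have : 1 / ((n : ℝ) + 1) ≤ 1 := by
    rw [div_le_one (by positivity)]; linarith [n.cast_nonneg (α := ℝ)]
  linarith

lemma radius_lt (n : ℕ) : 1 - 1 / ((n : ℝ) + 1) < 1 := by
  have : 0 < 1 / ((n : ℝ) + 1) := by positivity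
  linarith

lemma IsBoundedAnalytic.tendsto_dilate {Γ : ℂ → F →L[ℂ] E} (h : IsBoundedAnalytic Γ)
    (f : Hardy F) :
    Filter.Tendsto (id fun n : ℕ =>
        ((ofSummable _ (summable_taylorCoeff (h.diff_mul f) (radius_nonneg n) (radius_lt n)) :
          Hardy E) : ℕ → E))
      Filter.atTop (nhds (taylorCoeff fun z => Γ z (f.toFun z))) := by
  rw [tendsto_pi_nhds]
  intro k
  have h1 : Filter.Tendsto (fun n : ℕ => ((1 - 1 / ((n : ℝ) + 1) : ℝ) : ℂ) ^ k)
      Filter.atTop (nhds 1) := by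
    have := ((Complex.continuous_ofReal.tendsto 1).comp tendsto_radius).pow k
    simpa using this
  have h2 := h1.smul_const (taylorCoeff (fun z => Γ z (f.toFun z)) k)
  rw [one_smul] at h2
  exact h2

/-- The function `z ↦ Γ(z) f(z)` belongs to `H²_E(𝔻)`. -/
lemma IsBoundedAnalytic.memlp {Γ : ℂ → F →L[ℂ] E} (h : IsBoundedAnalytic Γ) (f : Hardy F) :
    Memℓp (taylorCoeff fun z => Γ z (f.toFun z)) 2 :=
  lp.memℓp_of_tendsto
    (isBounded_iff_forall_norm_le.2 ⟨h.bound * ‖f‖, by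
      rintro _ ⟨n, rfl⟩
      exact h.dilate f (radius_nonneg n) (radius_lt n)⟩)
    (h.tendsto_dilate f)

/-- The element of `H²_E(𝔻)` given by the function `z ↦ Γ(z) f(z)`. -/
def mulFun (Γ : ℂ → F →L[ℂ] E) (h : IsBoundedAnalytic Γ) (f : Hardy F) : Hardy E :=
  ⟨taylorCoeff fun z => Γ z (f.toFun z), h.memlp f⟩

lemma norm_mulFun_le (Γ : ℂ → F →L[ℂ] E) (h : IsBoundedAnalytic Γ) (f : Hardy F) :
    ‖mulFun Γ h f‖ ≤ h.bound * ‖f‖ :=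
  lp.norm_le_of_tendsto
    (Filter.Eventually.of_forall fun n => h.dilate f (radius_nonneg n) (radius_lt n))
    (h.tendsto_dilate f)

lemma mulFun_toFun (Γ : ℂ → F →L[ℂ] E) (h : IsBoundedAnalytic Γ) (f : Hardy F) {z : ℂ}
    (hz : ‖z‖ < 1) : (mulFun Γ h f).toFun z = Γ z (f.toFun z) :=
  (hasSum_taylorCoeff (h.diff_mul f) hz).tsum_eq

lemma toFun_add (f g : Hardy E) {z : ℂ} (hz : ‖z‖ < 1) :
    (f + g).toFun z = f.toFun z + g.toFun z := by
  rw [Hardy.toFun, Hardy.toFun, Hardy.toFun,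
    ← (summable_toFun f hz).of_norm.tsum_add (summable_toFun g hz).of_norm]
  exact tsum_congr fun k => by rw [← smul_add]; rfl

lemma toFun_smul (c : ℂ) (f : Hardy E) {z : ℂ} (hz : ‖z‖ < 1) :
    (c • f).toFun z = c • f.toFun z := by
  rw [Hardy.toFun, Hardy.toFun, ← (summable_toFun f hz).of_norm.tsum_const_smul c]
  exact tsum_congr fun k => by rw [smul_comm c]; rfl

/-- An element of the Hardy space is determined by its function on the disc. -/
lemma toFun_injective (f g : Hardy E) (h : ∀ z : ℂ, ‖z‖ < 1 → f.toFun z = g.toFun z) : f = g := by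
  have hp (f : Hardy E) : HasFPowerSeriesAt f.toFun
      (fun n => ContinuousMultilinearMap.mkPiRing ℂ (Fin n) (f n)) 0 := by
    refine hasFPowerSeriesAt_iff.2 ?_
    filter_upwards [Metric.ball_mem_nhds (0 : ℂ) one_pos] with z hz
    rw [mem_ball_zero_iff] at hz
    have := (summable_toFun f hz).of_norm.hasSum
    simpa [FormalMultilinearSeries.coeff, Hardy.toFun] using this
  have hfg : f.toFun =ᶠ[nhds 0] g.toFun := by
    filter_upwards [Metric.ball_mem_nhds (0 : ℂ) one_pos] with z hz
    exact h z (mem_ball_zero_iff.1 hz)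
  have := (hp f).eq_formalMultilinearSeries_of_eventually (hp g) hfg
  ext n
  have hn := congrArg (fun p : FormalMultilinearSeries ℂ ℂ E => p.coeff n) this
  simpa [FormalMultilinearSeries.coeff] using hn

/-- The multiplication operator `M_Γ : H²_F(𝔻) → H²_E(𝔻)`, `(M_Γ f)(z) = Γ(z) f(z)`. -/
def mulOp (Γ : ℂ → F →L[ℂ] E) (h : IsBoundedAnalytic Γ) : Hardy F →L[ℂ] Hardy E :=
  LinearMap.mkContinuous
    { toFun := mulFun Γ h
      map_add' := by
        intro f g
        refine toFun_injective _ _ fun z hz => ?_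
        rw [toFun_add _ _ hz, mulFun_toFun _ _ _ hz, mulFun_toFun _ _ _ hz, mulFun_toFun _ _ _ hz,
          toFun_add _ _ hz, map_add]
      map_smul' := by
        intro c f
        refine toFun_injective _ _ fun z hz => ?_
        rw [RingHom.id_apply, toFun_smul _ _ hz, mulFun_toFun _ _ _ hz, mulFun_toFun _ _ _ hz,
          toFun_smul _ _ hz, map_smul] }
    h.bound (norm_mulFun_le Γ h)

/-- The defining property of `M_Γ`. -/
theorem mulOp_toFun (Γ : ℂ → F →L[ℂ] E) (h : IsBoundedAnalytic Γ) (f : Hardy F) {z : ℂ}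
    (hz : ‖z‖ < 1) : (mulOp Γ h f).toFun z = Γ z (f.toFun z) :=
  mulFun_toFun Γ h f hz

/-- A constant operator `A ∈ B(F,E)` acting as an operator `H²_F(𝔻) → H²_E(𝔻)`,
`(A f)(z) = A (f(z))`. -/
def constOp (A : F →L[ℂ] E) : Hardy F →L[ℂ] Hardy E :=
  mulOp (fun _ => A) (isBoundedAnalytic_const A)

end Multiplication

end HardyToeplitz

end

open HardyToeplitz

noncomputable section

open MeasureTheory AddCircle Filter Topology ContinuousLinearMap ComplexConjugate

namespace HardyToeplitz

/-! ### Symbols from `L²`-valued linear maps -/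

section Lifting

variable {E : Type*} [NormedAddCommGroup E] [InnerProductSpace ℂ E]

/-! Put `G = Γ - Γ(0)`, `P = Ψ - Ψ(0)` and `R = M_G M_P^*`. Expanding the product shows that `R` is
`M_Γ M_Ψ^*` minus the right-hand side of the third condition (`mulOp_sub_const_comp_adjoint`), so
that condition says `R = 0`. Since `M_P^*` sends the Szegő kernel `k_w x` to `k_w P(w)^* x`, the
value of `R k_w x` at `z` is `(1 - z conj w)⁻¹ G(z) P(w)^* x`; hence `R = 0` is also the second
condition (`mulOp_comp_adjoint_mulOp_eq_zero_iff`).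

The right-hand side is always Toeplitz, being a sum of an analytic, a coanalytic and a constant
Toeplitz operator (`isToeplitz_add_sub_constOp`), so the third condition implies the first.
Conversely, if `M_Γ M_Ψ^*` is Toeplitz, then the matrix of `R` is constant along diagonals. As `G(0)
= P(0) = 0`, both `R` and `R^*` annihilate the constants: the first column and the first row vanish,
and `R = 0` (`HasConstantDiagonals.eq_zero`).

The analytic work is to find symbols for `M_H` and `M_H^*` when `E` may be nonseparable. For each
`x` the boundary function of `H x` is bounded almost everywhere, but the exceptional null set
depends on `x`. `exists_symbol` produces an operator at every point of the circle by averaging over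
shrinking balls and passing to an ultrafilter limit. -/

lemma haarAddCircle_eq_volume : (haarAddCircle : Measure UnitAddCircle) = volume := by
  rw [volume_eq_smul_haarAddCircle]; simp

/-- A bounded sequence in `ℂ` converges along every ultrafilter. -/
lemma exists_tendsto_ultrafilter (U : Ultrafilter ℕ) {a : ℕ → ℂ} {C : ℝ} (h : ∀ n, ‖a n‖ ≤ C) :
    ∃ l : ℂ, Tendsto a U (𝓝 l) := by
  obtain ⟨l, -, hl⟩ := (isCompact_closedBall (0 : ℂ) C).ultrafilter_le_nhds (U.map a)
    (by
      rw [le_principal_iff, Ultrafilter.mem_coe, Ultrafilter.mem_map]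
      exact Filter.univ_mem' fun n => by simpa using h n)
  exact ⟨l, hl⟩

/-- A bounded sequence of operators has a generalized weak limit, which is the strong limit at
every vector where the strong limit exists. -/
lemma exists_generalized_limit [CompleteSpace E] {A : ℕ → E →L[ℂ] E} {C : ℝ}
    (h : ∀ n, ‖A n‖ ≤ C) :
    ∃ Φ : E →L[ℂ] E, ‖Φ‖ ≤ C ∧ ∀ x v, Tendsto (fun n => A n x) atTop (𝓝 v) → Φ x = v := by
  have hC : 0 ≤ C := (norm_nonneg _).trans (h 0)
  -- A nonprincipal ultrafilter: every bounded scalar sequence converges along it, and ordinary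
  -- limits are preserved.
  let U : Ultrafilter ℕ := hyperfilter ℕ
  have hU : (U : Filter ℕ) ≤ atTop := by
    rw [← Nat.cofinite_eq_atTop]; exact hyperfilter_le_cofinite
  have hb (x y : E) (n : ℕ) : ‖inner ℂ (A n x) y‖ ≤ C * ‖x‖ * ‖y‖ :=
    (norm_inner_le_norm _ _).trans
      (mul_le_mul_of_nonneg_right ((A n).le_of_opNorm_le (h n) x) (norm_nonneg y))
  choose l hl using fun x y => exists_tendsto_ultrafilter U (hb x y)
  have hlb (x y : E) : ‖l x y‖ ≤ C * ‖x‖ * ‖y‖ :=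
    le_of_tendsto (hl x y).norm (Eventually.of_forall (hb x y))
  -- The limits of the matrix coefficients form a bounded sesquilinear form; the Riesz
  -- representation turns it into an operator.
  let B : E →L⋆[ℂ] E →L[ℂ] ℂ := LinearMap.mkContinuous₂
    (LinearMap.mk₂'ₛₗ (starRingEnd ℂ) (RingHom.id ℂ) l
      (fun x x' y => tendsto_nhds_unique (hl _ _) <| by
        simpa [inner_add_left] using (hl x y).add (hl x' y))
      (fun c x y => tendsto_nhds_unique (hl _ _) <| by
        simpa [inner_smul_left, mul_comm] using (hl x y).const_mul (conj c))
      (fun x y y' => tendsto_nhds_unique (hl _ _) <| by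
        simpa [inner_add_right] using (hl x y).add (hl x y'))
      (fun c x y => tendsto_nhds_unique (hl _ _) <| by
        simpa [inner_smul_right] using (hl x y).const_mul c))
    C hlb
  have hΦ (x y : E) : inner ℂ (InnerProductSpace.continuousLinearMapOfBilin B x) y = l x y :=
    InnerProductSpace.continuousLinearMapOfBilin_apply B x y
  refine ⟨InnerProductSpace.continuousLinearMapOfBilin B, ?_, fun x v hv => ?_⟩
  · refine ContinuousLinearMap.opNorm_le_of_re_inner_le hC fun x y hx hy => ?_
    rw [hΦ]
    simpa [hx, hy] using (Complex.re_le_norm _).trans (hlb x y)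
  · refine ext_inner_right ℂ fun y => ?_
    rw [hΦ]
    exact tendsto_nhds_unique (hl x y) ((hv.mono_left hU).inner tendsto_const_nhds)

/-! ### Ball averages and Lebesgue differentiation -/

lemma LTwo.integrable (f : LTwo E) : Integrable f haarAddCircle :=
  (Lp.memLp f).integrable (by norm_num)

/-- The average of a function in `L²_E(𝕋)` over a ball. -/
def ballAverage (f : LTwo E) (t : UnitAddCircle) (r : ℝ) : E :=
  ⨍ s in Metric.closedBall t r, f s ∂haarAddCircle

/-- Averages do not see the choice of representatives, so additivity holds at every `t` and not just
almost everywhere. This is what makes the averages at a fixed `t` a linear function of the vector.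
-/
lemma ballAverage_add (f g : LTwo E) (t : UnitAddCircle) (r : ℝ) :
    ballAverage (f + g) t r = ballAverage f t r + ballAverage g t r := by
  simp only [ballAverage, setAverage_eq]
  rw [setIntegral_congr_ae₀ (g := fun s => f s + g s)
    Metric.isClosed_closedBall.measurableSet.nullMeasurableSet
    ((Lp.coeFn_add f g).mono fun s hs _ => hs),
    integral_add (LTwo.integrable f).integrableOn (LTwo.integrable g).integrableOn, smul_add]

lemma ballAverage_smul (c : ℂ) (f : LTwo E) (t : UnitAddCircle) (r : ℝ) :
    ballAverage (c • f) t r = c • ballAverage f t r := by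
  simp only [ballAverage, setAverage_eq]
  rw [setIntegral_congr_ae₀ (g := fun s => c • f s)
    Metric.isClosed_closedBall.measurableSet.nullMeasurableSet
    ((Lp.coeFn_smul c f).mono fun s hs _ => hs), integral_smul, smul_comm]

lemma norm_ballAverage_le {f : LTwo E} {C : ℝ} (hC : 0 ≤ C)
    (h : ∀ᵐ t ∂(haarAddCircle : Measure UnitAddCircle), ‖f t‖ ≤ C) (t : UnitAddCircle) (r : ℝ) :
    ‖ballAverage f t r‖ ≤ C := by
  have h1 := norm_setIntegral_le_of_norm_le_const_ae' (μ := (haarAddCircle : Measure UnitAddCircle))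
    (s := Metric.closedBall t r) (measure_lt_top _ _) (h.mono fun s hs _ => hs)
  rw [ballAverage, setAverage_eq, norm_smul, norm_inv, Real.norm_of_nonneg measureReal_nonneg]
  refine inv_mul_le_of_le_mul₀ measureReal_nonneg hC ?_
  rwa [mul_comm]

lemma tendsto_ballAverage [CompleteSpace E] (f : LTwo E) :
    ∀ᵐ t ∂(haarAddCircle : Measure UnitAddCircle),
      Tendsto (fun n : ℕ => ballAverage f t (1 / ((n : ℝ) + 1))) atTop (𝓝 (f t)) := by
  have hf : LocallyIntegrable f (volume : Measure UnitAddCircle) := by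
    rw [← haarAddCircle_eq_volume]; exact (LTwo.integrable f).locallyIntegrable
  -- The constant `1` only has to allow balls centred at the point itself.
  have h := IsUnifLocDoublingMeasure.ae_tendsto_average (volume : Measure UnitAddCircle) hf 1
  rw [← haarAddCircle_eq_volume] at h
  filter_upwards [h] with t ht
  refine ht (fun _ => t) _ ?_ (Eventually.of_forall fun n => ?_)
  · exact tendsto_nhdsWithin_iff.2 ⟨tendsto_one_div_add_atTop_nhds_zero_nat,
      Eventually.of_forall fun n => Set.mem_Ioi.2 (by positivity)⟩
  · exact Metric.mem_closedBall_self (by positivity)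

/-- A linear map `g : E → L²_E(𝕋)` with `‖g x‖ ≤ C ‖x‖` pointwise almost everywhere is given by a
symbol. The space `E` need not be separable. -/
theorem exists_symbol [CompleteSpace E] (g : E →ₗ[ℂ] LTwo E) {C : ℝ} (hC : 0 ≤ C)
    (h : ∀ x, ∀ᵐ t ∂(haarAddCircle : Measure UnitAddCircle), ‖g x t‖ ≤ C * ‖x‖) :
    ∃ Φ : UnitAddCircle → E →L[ℂ] E, IsSymbol Φ ∧
      ∀ x, (fun t => Φ t x) =ᵐ[haarAddCircle] g x := by
  -- Linearity and the bound `C` hold for every `t`, with no null set to discard. Null sets enter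
  -- only in `key`, where `x` is fixed.
  let A (t : UnitAddCircle) (n : ℕ) : E →L[ℂ] E := LinearMap.mkContinuous
    { toFun := fun x => ballAverage (g x) t (1 / ((n : ℝ) + 1))
      map_add' := fun x y => by rw [map_add, ballAverage_add]
      map_smul' := fun c x => by rw [map_smul, ballAverage_smul, RingHom.id_apply] }
    C fun x => norm_ballAverage_le (by positivity) (h x) t _
  choose Φ hΦ hlim using fun t =>
    exists_generalized_limit fun n => (LinearMap.mkContinuous_norm_le _ hC _ : ‖A t n‖ ≤ C)
  have key (x : E) : (fun t => Φ t x) =ᵐ[haarAddCircle] g x := by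
    filter_upwards [tendsto_ballAverage (g x)] with t ht
    exact hlim t x _ ht
  exact ⟨Φ, ⟨fun x => (Lp.aestronglyMeasurable (g x)).congr (key x).symm,
    C, Eventually.of_forall hΦ⟩, key⟩

end Lifting

set_option linter.unusedSectionVars false

variable {E F : Type*} [NormedAddCommGroup E] [InnerProductSpace ℂ E]
  [NormedAddCommGroup F] [InnerProductSpace ℂ F]

/-! ### Monomials and the shift -/

/-- The monomial `z ↦ zⁱ x` as an element of the Hardy space. -/
def monomial (i : ℕ) (x : E) : Hardy E := lp.single 2 i x

lemma monomial_apply_self (i : ℕ) (x : E) : monomial i x i = x := lp.single_apply_self _ _ _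

lemma monomial_apply_ne {i j : ℕ} (h : j ≠ i) (x : E) : monomial i x j = 0 :=
  lp.single_apply_ne _ _ _ h

lemma monomial_add (i : ℕ) (x y : E) : monomial i (x + y) = monomial i x + monomial i y :=
  lp.single_add _ _ _ _

lemma monomial_smul (i : ℕ) (c : ℂ) (x : E) : monomial i (c • x) = c • monomial i x :=
  lp.single_smul _ _ _ _

lemma inner_monomial_left (i : ℕ) (x : E) (f : Hardy E) :
    inner ℂ (monomial i x) f = inner ℂ x (f i) := lp.inner_single_left _ _ _

lemma inner_monomial_right (i : ℕ) (x : E) (f : Hardy E) :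
    inner ℂ f (monomial i x) = inner ℂ (f i) x := lp.inner_single_right _ _ _

/-- Bounded operators on the Hardy space which agree on monomials are equal. -/
lemma ext_monomial {G : Type*} [NormedAddCommGroup G] [NormedSpace ℂ G] {S T : Hardy E →L[ℂ] G}
    (h : ∀ i x, S (monomial i x) = T (monomial i x)) : S = T :=
  lp.ext_continuousLinearMap (by norm_num) fun i => ContinuousLinearMap.ext fun x => h i x

lemma ext_inner_monomial {S T : Hardy E →L[ℂ] Hardy F}
    (h : ∀ i j x y, inner ℂ (monomial j y) (S (monomial i x))
      = inner ℂ (monomial j y) (T (monomial i x))) : S = T := by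
  refine ext_monomial fun i x => lp.ext (funext fun j => ext_inner_left ℂ fun y => ?_)
  simpa only [inner_monomial_left] using h i j x y

lemma toFun_monomial (i : ℕ) (x : E) (z : ℂ) : (monomial i x).toFun z = z ^ i • x := by
  rw [Hardy.toFun, tsum_eq_single i fun j hj => by rw [monomial_apply_ne hj, smul_zero],
    monomial_apply_self]

lemma toFun_zero_eq_apply (f : Hardy E) : f.toFun 0 = f 0 := by
  rw [Hardy.toFun, tsum_eq_single 0 fun j hj => by rw [zero_pow hj, zero_smul], pow_zero, one_smul]

variable [CompleteSpace E] [CompleteSpace F]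

lemma isBoundedAnalytic_smul_id : IsBoundedAnalytic fun z : ℂ => z • ContinuousLinearMap.id ℂ E :=
  ⟨by fun_prop, 1, fun z hz => by
    rw [norm_smul]
    exact mul_le_one₀ (mem_ball_zero_iff.1 hz).le (norm_nonneg _) ContinuousLinearMap.norm_id_le⟩

/-- The unilateral shift `f ↦ z f`. -/
def shift (E : Type*) [NormedAddCommGroup E] [InnerProductSpace ℂ E] [CompleteSpace E] :
    Hardy E →L[ℂ] Hardy E :=
  mulOp _ isBoundedAnalytic_smul_id

lemma shift_toFun (f : Hardy E) {z : ℂ} (hz : ‖z‖ < 1) : (shift E f).toFun z = z • f.toFun z := by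
  rw [shift, mulOp_toFun _ _ _ hz]; rfl

lemma shift_monomial (i : ℕ) (x : E) : shift E (monomial i x) = monomial (i + 1) x :=
  toFun_injective _ _ fun z hz => by
    rw [shift_toFun _ hz, toFun_monomial, toFun_monomial, smul_smul, pow_succ']

lemma mulOp_shift (Γ : ℂ → F →L[ℂ] E) (h : IsBoundedAnalytic Γ) (f : Hardy F) :
    mulOp Γ h (shift F f) = shift E (mulOp Γ h f) :=
  toFun_injective _ _ fun z hz => by
    rw [mulOp_toFun _ _ _ hz, shift_toFun _ hz, shift_toFun _ hz, mulOp_toFun _ _ _ hz, map_smul]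

/-! ### Toeplitz operators by their matrix entries -/

lemma boundary_monomial (i : ℕ) (x : E) : boundary E (monomial i x) = mono E i x :=
  (orthogonalFamily_mono (E := E)).linearIsometry_apply_single x

lemma boundary_monomial_ae (i : ℕ) (x : E) :
    boundary E (monomial i x) =ᵐ[haarAddCircle] fun t => fourier (i : ℤ) t • x := by
  rw [boundary_monomial]
  exact coe_toLp (monoC i x)

lemma laurent_ae (Φ : UnitAddCircle → E →L[ℂ] E) (h : IsSymbol Φ) (f : LTwo E) :
    laurent Φ h f =ᵐ[haarAddCircle] fun t => Φ t (f t) :=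
  (h.memLp f).coeFn_toLp

/-- The entries are Fourier coefficients of the scalar functions `⟪y, Φ(t) x⟫`, so they depend on
`i` and `j` only through `i - j`. -/
lemma inner_laurent_monomial (Φ : UnitAddCircle → E →L[ℂ] E) (h : IsSymbol Φ) (i j : ℕ) (x y : E) :
    inner ℂ (boundary E (monomial j y)) (laurent Φ h (boundary E (monomial i x)))
      = ∫ t, fourier ((i : ℤ) - j) t * inner ℂ y (Φ t x) ∂haarAddCircle := by
  rw [L2.inner_def]
  refine integral_congr_ae ?_
  filter_upwards [boundary_monomial_ae i x, boundary_monomial_ae j y,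
    laurent_ae Φ h (boundary E (monomial i x))] with t h1 h2 h3
  rw [h3, h1, h2, map_smul, inner_smul_left, inner_smul_right, sub_eq_add_neg, fourier_add,
    fourier_neg]
  ring

/-- The compression of `L` to the Hardy space is `T` iff both have the same matrix entries. -/
lemma boundary_eq_starProjection_iff (L : LTwo E →L[ℂ] LTwo E) (T : Hardy E →L[ℂ] Hardy E) :
    (∀ f, boundary E (T f) = (hardyTorus E).starProjection (L (boundary E f))) ↔
      ∀ i j x y, inner ℂ (monomial j y) (T (monomial i x))
        = inner ℂ (boundary E (monomial j y)) (L (boundary E (monomial i x))) := by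
  have mem (f : Hardy E) : boundary E f ∈ hardyTorus E := LinearMap.mem_range_self _ f
  constructor
  · intro h i j x y
    rw [← (boundary E).inner_map_map, h, ← Submodule.inner_starProjection_left_eq_right,
      Submodule.starProjection_eq_self_iff.2 (mem _)]
  · intro h f
    -- Monomials determine bounded operators, so equal entries give `T = B^* L B`. Hence `L B f - B
    -- T f` is orthogonal to the range of `B`, which characterizes the projection.
    let B : Hardy E →L[ℂ] LTwo E := (boundary E).toContinuousLinearMap
    have hT : T = adjoint B ∘L L ∘L B := by
      refine ext_inner_monomial fun i j x y => ?_
      rw [h, comp_apply, adjoint_inner_right]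
      rfl
    refine (Submodule.eq_starProjection_of_mem_of_inner_eq_zero (mem _) ?_).symm
    rintro _ ⟨g, rfl⟩
    rw [inner_sub_left, sub_eq_zero]
    change inner ℂ (L (boundary E f)) (boundary E g) = inner ℂ (boundary E (T f)) (boundary E g)
    rw [(boundary E).inner_map_map, hT, comp_apply, adjoint_inner_left]
    rfl

/-- Removes the projection from the definition, so that adjoints and diagonals can be handled
through Fourier coefficients. -/
lemma isToeplitz_iff_inner (T : Hardy E →L[ℂ] Hardy E) :
    IsToeplitz T ↔ ∃ Φ : UnitAddCircle → E →L[ℂ] E, IsSymbol Φ ∧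
      ∀ i j x y, inner ℂ (monomial j y) (T (monomial i x))
        = ∫ t, fourier ((i : ℤ) - j) t * inner ℂ y (Φ t x) ∂haarAddCircle := by
  constructor
  · rintro ⟨Φ, hΦ, h⟩
    refine ⟨Φ, hΦ, fun i j x y => ?_⟩
    rw [(boundary_eq_starProjection_iff _ T).1 h, inner_laurent_monomial]
  · rintro ⟨Φ, hΦ, h⟩
    refine ⟨Φ, hΦ, (boundary_eq_starProjection_iff _ T).2 fun i j x y => ?_⟩
    rw [h, inner_laurent_monomial]

/-! ### Constant diagonals and sums of Toeplitz operators -/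

/-- The matrix of `T` with respect to the monomials is constant along diagonals. -/
def HasConstantDiagonals (T : Hardy E →L[ℂ] Hardy E) : Prop :=
  ∀ i j x y, inner ℂ (monomial (j + 1) y) (T (monomial (i + 1) x))
    = inner ℂ (monomial j y) (T (monomial i x))

lemma IsToeplitz.hasConstantDiagonals {T : Hardy E →L[ℂ] Hardy E} (h : IsToeplitz T) :
    HasConstantDiagonals T := by
  obtain ⟨Φ, hΦ, h⟩ := (isToeplitz_iff_inner T).1 h
  intro i j x y
  rw [h, h]
  push_cast
  simp only [add_sub_add_right_eq_sub]

lemma HasConstantDiagonals.sub {S T : Hardy E →L[ℂ] Hardy E} (hS : HasConstantDiagonals S)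
    (hT : HasConstantDiagonals T) : HasConstantDiagonals (S - T) := by
  intro i j x y
  rw [sub_apply, sub_apply, inner_sub_right, inner_sub_right, hS, hT]

/-- An operator with constant diagonals is determined by its first row and first column. -/
lemma HasConstantDiagonals.eq_zero {T : Hardy E →L[ℂ] Hardy E} (h : HasConstantDiagonals T)
    (h1 : ∀ x, T (monomial 0 x) = 0) (h2 : ∀ y, ContinuousLinearMap.adjoint T (monomial 0 y) = 0) :
    T = 0 := by
  refine ext_inner_monomial fun i => ?_
  -- Go back along the diagonal until the border of the matrix is reached; `j` stays general in the
  -- induction hypothesis.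
  induction i with
  | zero => intro j x y; rw [h1, zero_apply]
  | succ i ih =>
    intro j x y
    cases j with
    | zero => rw [← adjoint_inner_left, h2, inner_zero_left, zero_apply, inner_zero_right]
    | succ j => rw [h, ih, zero_apply, zero_apply, inner_zero_right, inner_zero_right]

lemma IsSymbol.add {Φ Ψ : UnitAddCircle → E →L[ℂ] E} (hΦ : IsSymbol Φ) (hΨ : IsSymbol Ψ) :
    IsSymbol fun t => Φ t + Ψ t := by
  refine ⟨fun x => (hΦ.meas x).add (hΨ.meas x), ?_⟩
  obtain ⟨C, hC⟩ := hΦ.bdd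
  obtain ⟨D, hD⟩ := hΨ.bdd
  refine ⟨C + D, ?_⟩
  filter_upwards [hC, hD] with t h1 h2
  exact (norm_add_le _ _).trans (add_le_add h1 h2)

lemma IsToeplitz.add {S T : Hardy E →L[ℂ] Hardy E} (hS : IsToeplitz S) (hT : IsToeplitz T) :
    IsToeplitz (S + T) := by
  obtain ⟨Φ, hΦ, h1⟩ := hS
  obtain ⟨Ψ, hΨ, h2⟩ := hT
  refine ⟨_, hΦ.add hΨ, fun f => ?_⟩
  rw [add_apply, map_add, h1, h2, ← map_add]
  congr 1

/-! ### Boundary values of bounded functions -/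

/-- The dilate `z ↦ f(rz)`, for `0 ≤ r < 1`. -/
def dilation (f : Hardy E) {r : ℝ} (hr0 : 0 ≤ r) (hr : r < 1) : Hardy E :=
  ofSummable _ (summable_toFun f (z := (r : ℂ))
    (by rwa [Complex.norm_real, Real.norm_of_nonneg hr0]))

lemma dilation_apply (f : Hardy E) {r : ℝ} (hr0 : 0 ≤ r) (hr : r < 1) (k : ℕ) :
    dilation f hr0 hr k = (r : ℂ) ^ k • f k := rfl

lemma summable_dilation (f : Hardy E) {r : ℝ} (hr0 : 0 ≤ r) (hr : r < 1) :
    Summable fun k => ‖dilation f hr0 hr k‖ :=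
  summable_toFun f (z := (r : ℂ)) (by rwa [Complex.norm_real, Real.norm_of_nonneg hr0])

lemma dilation_toFun (f : Hardy E) {r : ℝ} (hr0 : 0 ≤ r) (hr : r < 1) (w : ℂ) :
    (dilation f hr0 hr).toFun w = f.toFun (r * w) :=
  tsum_congr fun k => by rw [dilation_apply, smul_smul, mul_pow, mul_comm]

/-- By Parseval the squared distance is `∑ (1 - r^k)² ‖f k‖²`, with terms dominated by `‖f k‖²` and
tending to `0` as `r → 1`. -/
lemma tendsto_dilation (f : Hardy E) :
    Tendsto (fun n : ℕ => dilation f (radius_nonneg n) (radius_lt n)) atTop (𝓝 f) := by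
  rw [tendsto_iff_norm_sub_tendsto_zero]
  have hn (g : Hardy E) : ‖g‖ ^ 2 = ∑' k, ‖g k‖ ^ 2 := by
    simpa using lp.norm_rpow_eq_tsum (p := 2) (by norm_num) g
  have hs : Summable fun k => ‖f k‖ ^ 2 := by
    simpa using (lp.memℓp f).summable (by norm_num)
  have h : Tendsto (fun n : ℕ => ∑' k,
      ‖(dilation f (radius_nonneg n) (radius_lt n) - f) k‖ ^ 2) atTop (𝓝 (∑' _ : ℕ, (0 : ℝ))) := by
    have e (n k : ℕ) : ‖(dilation f (radius_nonneg n) (radius_lt n) - f) k‖ ^ 2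
        = (1 - (1 - 1 / ((n : ℝ) + 1)) ^ k) ^ 2 * ‖f k‖ ^ 2 := by
      rw [lp.coeFn_sub, Pi.sub_apply, dilation_apply, ← neg_sub, norm_neg]
      nth_rw 1 [← one_smul ℂ (f k)]
      rw [← sub_smul, norm_smul, mul_pow]
      congr 1
      rw [← Complex.ofReal_one, ← Complex.ofReal_pow, ← Complex.ofReal_sub, Complex.norm_real,
        Real.norm_eq_abs, sq_abs]
    refine tendsto_tsum_of_dominated_convergence hs (fun k => ?_)
      (Eventually.of_forall fun n k => ?_)
    · simp only [e]
      have := (((tendsto_radius.pow k).const_sub 1).pow 2).mul_const (‖f k‖ ^ 2)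
      simpa using this
    · rw [e, Real.norm_of_nonneg (by positivity)]
      refine mul_le_of_le_one_left (by positivity) ?_
      have h1 := pow_le_one₀ (n := k) (radius_nonneg n) (radius_lt n).le
      have h2 := pow_nonneg (radius_nonneg n) k
      exact pow_le_one₀ (by linarith) (by linarith)
  simp only [← hn, tsum_zero] at h
  have := h.sqrt
  simpa [Real.sqrt_sq] using this

/-- The boundary functions of the dilates take values of `f` inside the disc, so they obey the
bound. They converge in `L²`, hence almost everywhere along a subsequence, and the bound survives in
the limit. -/
lemma norm_boundary_le (f : Hardy E) {C : ℝ} (h : ∀ z : ℂ, ‖z‖ < 1 → ‖f.toFun z‖ ≤ C) :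
    ∀ᵐ t ∂(haarAddCircle : Measure UnitAddCircle), ‖boundary E f t‖ ≤ C := by
  have h1 := ((boundary E).continuous.tendsto f).comp (tendsto_dilation f)
  obtain ⟨ns, -, hns⟩ := (tendstoInMeasure_of_tendsto_Lp h1).exists_seq_tendsto_ae
  -- One null set for all `n`, hence for the whole subsequence `ns`.
  have h2 : ∀ᵐ t ∂(haarAddCircle : Measure UnitAddCircle), ∀ n : ℕ,
      boundary E (dilation f (radius_nonneg n) (radius_lt n)) t
        = f.toFun ((1 - 1 / ((n : ℝ) + 1) : ℝ) * fourier (1 : ℤ) t) := by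
    refine ae_all_iff.2 fun n => ?_
    filter_upwards [boundary_ae _ (summable_dilation f (radius_nonneg n) (radius_lt n))] with t ht
    rw [ht, dilation_toFun]
  filter_upwards [hns, h2] with t ht h2
  refine le_of_tendsto ht.norm (Eventually.of_forall fun n => ?_)
  rw [Function.comp_apply, h2]
  refine h _ ?_
  have hw : ‖fourier (T := (1 : ℝ)) (1 : ℤ) t‖ = 1 := Circle.norm_coe _
  rw [norm_mul, hw, mul_one, Complex.norm_real, Real.norm_of_nonneg (radius_nonneg _)]
  exact radius_lt _

/-! ### Analytic and coanalytic Toeplitz operators -/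

lemma isSymbol_fourier_smul : IsSymbol fun t : UnitAddCircle =>
    fourier (1 : ℤ) t • ContinuousLinearMap.id ℂ E := by
  refine ⟨fun x => ?_, 1, Eventually.of_forall fun t => ?_⟩
  · have : Continuous fun t : UnitAddCircle => fourier (1 : ℤ) t • x := by fun_prop
    exact this.aestronglyMeasurable
  · have hw : ‖fourier (T := (1 : ℝ)) (1 : ℤ) t‖ = 1 := Circle.norm_coe _
    rw [norm_smul, hw, one_mul]
    exact ContinuousLinearMap.norm_id_le

/-- Multiplication by `e^{2πit}` on `L²_E(𝕋)` extends the shift. -/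
lemma boundary_shift (f : Hardy E) :
    boundary E (shift E f) = laurent _ isSymbol_fourier_smul (boundary E f) := by
  have h : (boundary E).toContinuousLinearMap ∘L shift E
      = laurent _ isSymbol_fourier_smul ∘L (boundary E).toContinuousLinearMap := by
    refine ext_monomial fun i x => ?_
    change boundary E (shift E (monomial i x)) = laurent _ isSymbol_fourier_smul
      (boundary E (monomial i x))
    rw [shift_monomial]
    refine Lp.ext ?_
    filter_upwards [boundary_monomial_ae i x, boundary_monomial_ae (i + 1) x,
      laurent_ae _ isSymbol_fourier_smul (boundary E (monomial i x))] with t h1 h2 h3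
    rw [h2, h3, h1, smul_apply, id_apply, smul_smul, ← fourier_add, Nat.cast_add, Nat.cast_one,
      add_comm]
  exact DFunLike.congr_fun h f

/-- A bounded analytic function has a boundary symbol. -/
lemma exists_boundary_symbol (H : ℂ → E →L[ℂ] E) (h : IsBoundedAnalytic H) :
    ∃ (Φ : UnitAddCircle → E →L[ℂ] E) (hΦ : IsSymbol Φ),
      ∀ f, boundary E (mulOp H h f) = laurent Φ hΦ (boundary E f) := by
  let g : E →ₗ[ℂ] LTwo E :=
    { toFun := fun x => boundary E (mulOp H h (monomial 0 x))
      map_add' := fun x y => by rw [monomial_add, map_add, map_add]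
      map_smul' := fun c x => by rw [monomial_smul, map_smul, map_smul, RingHom.id_apply] }
  obtain ⟨Φ, hΦ, hg⟩ := exists_symbol g h.bound_nonneg fun x =>
    norm_boundary_le _ fun z hz => by
      rw [mulOp_toFun _ _ _ hz, toFun_monomial, pow_zero, one_smul]
      exact (H z).le_of_opNorm_le (h.norm_le hz) x
  refine ⟨Φ, hΦ, fun f => ?_⟩
  -- On constants this is the choice of `Φ`. Both sides commute with multiplication by `e^{2πit}`,
  -- which raises the degree.
  have key (i : ℕ) (x : E) :
      boundary E (mulOp H h (monomial i x)) = laurent Φ hΦ (boundary E (monomial i x)) := by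
    induction i with
    | zero =>
      refine Lp.ext ?_
      filter_upwards [hg x, laurent_ae Φ hΦ (boundary E (monomial 0 x)),
        boundary_monomial_ae 0 x] with t h1 h2 h3
      rw [h2, h3, Nat.cast_zero, fourier_zero, one_smul, h1]
      rfl
    | succ i ih =>
      rw [← shift_monomial, mulOp_shift, boundary_shift, boundary_shift, ih]
      refine Lp.ext ?_
      filter_upwards [laurent_ae Φ hΦ (boundary E (monomial i x)),
        laurent_ae _ isSymbol_fourier_smul (laurent Φ hΦ (boundary E (monomial i x))),
        laurent_ae _ isSymbol_fourier_smul (boundary E (monomial i x)),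
        laurent_ae Φ hΦ (laurent _ isSymbol_fourier_smul (boundary E (monomial i x)))]
        with t h1 h2 h3 h4
      rw [h2, h1, h4, h3]
      simp
  have hext : (boundary E).toContinuousLinearMap ∘L mulOp H h
      = laurent Φ hΦ ∘L (boundary E).toContinuousLinearMap := ext_monomial key
  exact DFunLike.congr_fun hext f

lemma isToeplitz_mulOp (H : ℂ → E →L[ℂ] E) (h : IsBoundedAnalytic H) : IsToeplitz (mulOp H h) := by
  obtain ⟨Φ, hΦ, hf⟩ := exists_boundary_symbol H h
  refine ⟨Φ, hΦ, fun f => ?_⟩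
  rw [← hf, Submodule.starProjection_eq_self_iff.2]
  exact LinearMap.mem_range_self _ _

/-- Taking adjoints is conjugate linear, so conjugating the variable as well restores holomorphy. -/
lemma IsBoundedAnalytic.adjoint_conj {H : ℂ → E →L[ℂ] E} (h : IsBoundedAnalytic H) :
    IsBoundedAnalytic fun z => adjoint (H (conj z)) := by
  have mem {z : ℂ} (hz : z ∈ Metric.ball (0 : ℂ) 1) : conj z ∈ Metric.ball (0 : ℂ) 1 := by
    simpa using hz
  refine ⟨fun z hz => ?_, h.bound, fun z hz => ?_⟩
  · have h1 := (h.diff.differentiableAt (Metric.isOpen_ball.mem_nhds (mem hz))).star_star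
    rw [← starRingEnd_apply, Complex.conj_conj] at h1
    exact h1.differentiableWithinAt
  · rw [LinearIsometryEquiv.norm_map]
    exact h.norm_le (mem_ball_zero_iff.1 (mem hz))

/-- An element of the Hardy space from a square-summable sequence dominated by another one. -/
lemma memlp_of_norm_le (f : Hardy F) (a : ℕ → E) {C : ℝ} (h : ∀ k, ‖a k‖ ≤ C * ‖f k‖) :
    Memℓp a 2 := by
  have hs : Summable fun k => ‖f k‖ ^ 2 := by
    simpa using (lp.memℓp f).summable (by norm_num)
  refine memℓp_gen ?_
  simp only [ENNReal.toReal_ofNat, Real.rpow_ofNat]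
  refine Summable.of_nonneg_of_le (fun _ => by positivity) (fun k => ?_) (hs.mul_left (C ^ 2))
  rw [← mul_pow]
  exact pow_le_pow_left₀ (norm_nonneg _) (h k) 2

/-- If `⟪y, f(z)⟫ = ⟪g(conj z), x⟫` on the disc, then the Taylor coefficients satisfy the
same relation. -/
lemma inner_apply_eq_of_toFun (f g : Hardy E) (x y : E)
    (h : ∀ z : ℂ, ‖z‖ < 1 → inner ℂ y (f.toFun z) = inner ℂ (g.toFun (conj z)) x) (i : ℕ) :
    inner ℂ y (f i) = inner ℂ (g i) x := by
  -- Both pairings are scalar power series in `z` (the two conjugations in the second cancel), so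
  -- uniqueness of coefficients applies.
  let a : Hardy ℂ := ⟨fun k => inner ℂ y (f k), memlp_of_norm_le f _ fun k => norm_inner_le_norm _ _⟩
  let b : Hardy ℂ := ⟨fun k => inner ℂ (g k) x,
    memlp_of_norm_le g (C := ‖x‖) _ fun k => (norm_inner_le_norm _ _).trans_eq (mul_comm _ _)⟩
  have hab : a = b := toFun_injective _ _ fun z hz => by
    have h1 : HasSum (fun k => z ^ k • inner ℂ y (f k)) (inner ℂ y (f.toFun z)) := by
      simpa [inner_smul_right, Hardy.toFun] using
        (summable_toFun f hz).of_norm.hasSum.mapL (innerSL ℂ y)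
    have h2 : HasSum (fun k => z ^ k • inner ℂ (g k) x) (inner ℂ (g.toFun (conj z)) x) := by
      have hs := (summable_toFun g (z := conj z) (by simpa using hz)).of_norm.hasSum
      have := (hs.mapL (innerSL ℂ x)).map (starRingEnd ℂ) Complex.continuous_conj
      simpa [Function.comp_def, inner_smul_right, Hardy.toFun] using this
    exact h1.tsum_eq.trans ((h z hz).trans h2.tsum_eq.symm)
  exact congrArg (fun u : Hardy ℂ => u i) hab

lemma IsSymbol.comp_neg {Φ : UnitAddCircle → E →L[ℂ] E} (h : IsSymbol Φ) :
    IsSymbol fun t => Φ (-t) := by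
  have hneg : MeasurePreserving (fun t : UnitAddCircle => -t) haarAddCircle haarAddCircle :=
    Measure.measurePreserving_neg _
  refine ⟨fun x => (h.meas x).comp_measurePreserving hneg, ?_⟩
  obtain ⟨C, hC⟩ := h.bdd
  exact ⟨C, hneg.quasiMeasurePreserving.tendsto_ae.eventually (p := fun t => ‖Φ t‖ ≤ C) hC⟩

/-- The symbol is `Φ(-t)`, with `Φ` a boundary symbol of `z ↦ H(conj z)^*`; the reflection exchanges
`i - j` and `j - i`. This avoids proving that pointwise adjoints of a symbol are strongly
measurable. -/
lemma isToeplitz_adjoint_mulOp (H : ℂ → E →L[ℂ] E) (h : IsBoundedAnalytic H) :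
    IsToeplitz (adjoint (mulOp H h)) := by
  obtain ⟨Φ, hΦ, hT⟩ := (isToeplitz_iff_inner _).1 (isToeplitz_mulOp _ h.adjoint_conj)
  refine (isToeplitz_iff_inner _).2 ⟨_, hΦ.comp_neg, fun i j x y => ?_⟩
  · have e : ∫ t, fourier ((i : ℤ) - j) t * inner ℂ y (Φ (-t) x) ∂haarAddCircle
        = ∫ t, fourier ((j : ℤ) - i) t * inner ℂ y (Φ t x) ∂haarAddCircle := by
      rw [← integral_neg_eq_self fun t => fourier ((j : ℤ) - i) t * inner ℂ y (Φ t x)]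
      refine integral_congr_ae (Eventually.of_forall fun t => ?_)
      simp only [fourier_apply, smul_neg, ← neg_smul, neg_sub]
    rw [e, ← hT, adjoint_inner_right, inner_monomial_left, inner_monomial_right]
    refine (inner_apply_eq_of_toFun _ _ _ _ (fun z hz => ?_) _).symm
    have hz' : ‖conj z‖ < 1 := by simpa using hz
    rw [mulOp_toFun _ _ _ hz, mulOp_toFun _ _ _ hz', toFun_monomial, toFun_monomial,
      adjoint_inner_right, map_smul, inner_smul_left, inner_smul_right, map_pow, Complex.conj_conj]

/-! ### Kernel functions -/

lemma summable_kernel {w : ℂ} (hw : ‖w‖ < 1) (x : E) :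
    Summable fun k : ℕ => ‖conj w ^ k • x‖ := by
  simp only [norm_smul, norm_pow, RCLike.norm_conj]
  exact (summable_geometric_of_lt_one (norm_nonneg w) hw).mul_right _

/-- The Szegő kernel function `z ↦ (1 - conj w z)⁻¹ x`. -/
def kernel {w : ℂ} (hw : ‖w‖ < 1) (x : E) : Hardy E := ofSummable _ (summable_kernel hw x)

lemma kernel_apply {w : ℂ} (hw : ‖w‖ < 1) (x : E) (k : ℕ) : kernel hw x k = conj w ^ k • x := rfl

/-- Reproducing property: pairing coefficients with `conj w ^ k • x` sums the series of `f` at `w`.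
-/
lemma inner_kernel {w : ℂ} (hw : ‖w‖ < 1) (x : E) (f : Hardy E) :
    inner ℂ (kernel hw x) f = inner ℂ x (f.toFun w) := by
  refine (lp.hasSum_inner (kernel hw x) f).unique ?_
  have := (summable_toFun f hw).of_norm.hasSum.mapL (innerSL ℂ x)
  simpa [kernel_apply, inner_smul_left, inner_smul_right, Hardy.toFun] using this

lemma kernel_toFun {w : ℂ} (hw : ‖w‖ < 1) (x : E) {z : ℂ} (hz : ‖z‖ < 1) :
    (kernel hw x).toFun z = (1 - z * conj w)⁻¹ • x := by
  have h : ‖z * conj w‖ < 1 := by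
    rw [norm_mul, RCLike.norm_conj]
    exact mul_lt_one_of_nonneg_of_lt_one_left (norm_nonneg _) hz hw.le
  rw [← tsum_geometric_of_norm_lt_one h, ← (summable_geometric_of_norm_lt_one h).tsum_smul_const]
  exact tsum_congr fun k => by rw [kernel_apply, smul_smul, mul_pow]

lemma adjoint_mulOp_kernel (Γ : ℂ → F →L[ℂ] E) (h : IsBoundedAnalytic Γ) {w : ℂ} (hw : ‖w‖ < 1)
    (x : E) : adjoint (mulOp Γ h) (kernel hw x) = kernel hw (adjoint (Γ w) x) := by
  refine ext_inner_right ℂ fun f => ?_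
  rw [adjoint_inner_left, inner_kernel, inner_kernel, mulOp_toFun _ _ _ hw, adjoint_inner_left]

/-- By the reproducing property, the values of `T^* f` at `w` are tested by pairing `f` with `T
(kernel hw x)`, so `T^*` vanishes. -/
lemma eq_zero_of_kernel {T : Hardy E →L[ℂ] Hardy F}
    (h : ∀ (w : ℂ) (hw : ‖w‖ < 1) (x : E), T (kernel hw x) = 0) : T = 0 := by
  have hT : adjoint T = 0 := by
    ext1 f
    refine toFun_injective _ _ fun w hw => ext_inner_left ℂ fun x => ?_
    rw [← inner_kernel hw, ← inner_kernel hw, adjoint_inner_right, h, inner_zero_left, zero_apply,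
      inner_zero_right]
  rw [← adjoint_adjoint T, hT, map_zero]

/-- `M_G M_P^* = 0` iff all products `G(z) P(w)^*` vanish. -/
lemma mulOp_comp_adjoint_mulOp_eq_zero_iff (G P : ℂ → F →L[ℂ] E) (hG : IsBoundedAnalytic G)
    (hP : IsBoundedAnalytic P) :
    mulOp G hG ∘L adjoint (mulOp P hP) = 0 ↔
      ∀ z ∈ Metric.ball (0 : ℂ) 1, ∀ w ∈ Metric.ball (0 : ℂ) 1, G z ∘L adjoint (P w) = 0 := by
  have key {z w : ℂ} (hz : ‖z‖ < 1) (hw : ‖w‖ < 1) (x : E) :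
      ((mulOp G hG ∘L adjoint (mulOp P hP)) (kernel hw x)).toFun z
        = (1 - z * conj w)⁻¹ • (G z ∘L adjoint (P w)) x := by
    rw [comp_apply, adjoint_mulOp_kernel, mulOp_toFun _ _ _ hz, kernel_toFun _ _ hz, map_smul,
      comp_apply]
  have zero_toFun (z : ℂ) : (0 : Hardy E).toFun z = 0 := by
    simp [Hardy.toFun]
  constructor
  · intro h z hz w hw
    rw [mem_ball_zero_iff] at hz hw
    ext x
    have := key hz hw x
    rw [h, zero_apply, zero_toFun, eq_comm, smul_eq_zero, inv_eq_zero] at this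
    -- The scalar factor is invertible because `‖z * conj w‖ < 1`.
    refine this.resolve_left fun h1 => ?_
    have h2 : ‖z * conj w‖ < 1 := by
      rw [norm_mul, RCLike.norm_conj]
      exact mul_lt_one_of_nonneg_of_lt_one_left (norm_nonneg _) hz hw.le
    rw [← sub_eq_zero.1 h1, norm_one] at h2
    exact lt_irrefl _ h2
  · intro h
    refine eq_zero_of_kernel fun w hw x => toFun_injective _ _ fun z hz => ?_
    rw [key hz hw, h z (mem_ball_zero_iff.2 hz) w (mem_ball_zero_iff.2 hw), zero_apply, smul_zero,
      zero_toFun]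

/-! ### Algebra of multiplication operators -/

lemma IsBoundedAnalytic.sub_const {Γ : ℂ → F →L[ℂ] E} (h : IsBoundedAnalytic Γ) (A : F →L[ℂ] E) :
    IsBoundedAnalytic fun z => Γ z - A :=
  ⟨h.diff.sub_const A, h.bound + ‖A‖, fun _ hz => (norm_sub_le _ _).trans
    (add_le_add_left (h.norm_le (mem_ball_zero_iff.1 hz)) _)⟩

lemma constOp_toFun (A : F →L[ℂ] E) (f : Hardy F) {z : ℂ} (hz : ‖z‖ < 1) :
    (constOp A f).toFun z = A (f.toFun z) := mulOp_toFun _ _ _ hz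

lemma adjoint_constOp (A : F →L[ℂ] E) : adjoint (constOp A) = constOp (adjoint A) := by
  refine sub_eq_zero.1 (eq_zero_of_kernel fun w hw x => ?_)
  rw [sub_apply, constOp, adjoint_mulOp_kernel, sub_eq_zero]
  refine toFun_injective _ _ fun z hz => ?_
  rw [constOp_toFun _ _ hz, kernel_toFun _ _ hz, kernel_toFun _ _ hz, map_smul]

lemma mulOp_sub_const (Γ : ℂ → F →L[ℂ] E) (h : IsBoundedAnalytic Γ) (A : F →L[ℂ] E) :
    mulOp (fun z => Γ z - A) (h.sub_const A) = mulOp Γ h - constOp A := by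
  refine ContinuousLinearMap.ext fun f => ?_
  rw [sub_apply, eq_sub_iff_add_eq]
  refine toFun_injective _ _ fun z hz => ?_
  rw [toFun_add _ _ hz, mulOp_toFun _ _ _ hz, mulOp_toFun _ _ _ hz, constOp_toFun _ _ hz, sub_apply,
    sub_add_cancel]

lemma constOp_comp_constOp (A B : F →L[ℂ] E) :
    constOp A ∘L constOp (adjoint B) = constOp (A ∘L adjoint B) := by
  refine ContinuousLinearMap.ext fun f => toFun_injective _ _ fun z hz => ?_
  rw [comp_apply, constOp_toFun _ _ hz, constOp_toFun _ _ hz, constOp_toFun _ _ hz, comp_apply]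

lemma IsBoundedAnalytic.comp_const {Γ : ℂ → F →L[ℂ] E} (h : IsBoundedAnalytic Γ) (A : E →L[ℂ] F) :
    IsBoundedAnalytic fun z => Γ z ∘L A :=
  ⟨h.diff.clm_comp (differentiableOn_const A), h.bound * ‖A‖, fun _ hz =>
    (opNorm_comp_le _ _).trans
      (mul_le_mul_of_nonneg_right (h.norm_le (mem_ball_zero_iff.1 hz)) (norm_nonneg _))⟩

lemma mulOp_comp_constOp (Γ : ℂ → F →L[ℂ] E) (h : IsBoundedAnalytic Γ) (A : E →L[ℂ] F) :
    mulOp Γ h ∘L constOp A = mulOp (fun z => Γ z ∘L A) (h.comp_const A) := by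
  refine ContinuousLinearMap.ext fun f => toFun_injective _ _ fun z hz => ?_
  rw [comp_apply, mulOp_toFun _ _ _ hz, constOp_toFun _ _ hz, mulOp_toFun _ _ _ hz, comp_apply]

/-- Absorbing the constant into the symbol exhibits the product as the adjoint of an analytic
multiplication, hence as Toeplitz when the symbol acts on `E`. -/
lemma constOp_comp_adjoint_mulOp (Γ : ℂ → F →L[ℂ] E) (h : IsBoundedAnalytic Γ) (A : F →L[ℂ] E) :
    constOp A ∘L adjoint (mulOp Γ h)
      = adjoint (mulOp (fun z => Γ z ∘L adjoint A) (h.comp_const (adjoint A))) := by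
  rw [← mulOp_comp_constOp, adjoint_comp, adjoint_constOp, adjoint_adjoint]

/-- If `P(0) = 0` then `M_P^*` annihilates the constants. -/
lemma adjoint_mulOp_monomial_zero (P : ℂ → F →L[ℂ] E) (h : IsBoundedAnalytic P) (h0 : P 0 = 0)
    (x : E) : adjoint (mulOp P h) (monomial 0 x) = 0 := by
  refine ext_inner_right ℂ fun f => ?_
  rw [adjoint_inner_left, inner_monomial_left, ← toFun_zero_eq_apply, mulOp_toFun _ _ _ (by simp),
    h0, zero_apply, inner_zero_right, inner_zero_left]

/-- Bilinear expansion of `(M_Γ - Γ(0)) (M_Ψ^* - Ψ(0)^*)`; it identifies the defect in the product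
formula with a single product. -/
lemma mulOp_sub_const_comp_adjoint (Γ Ψ : ℂ → F →L[ℂ] E) (hΓ : IsBoundedAnalytic Γ)
    (hΨ : IsBoundedAnalytic Ψ) :
    mulOp _ (hΓ.sub_const (Γ 0)) ∘L adjoint (mulOp _ (hΨ.sub_const (Ψ 0)))
      = mulOp Γ hΓ ∘L adjoint (mulOp Ψ hΨ)
        - (mulOp Γ hΓ ∘L constOp (adjoint (Ψ 0)) + constOp (Γ 0) ∘L adjoint (mulOp Ψ hΨ)
          - constOp (Γ 0 ∘L adjoint (Ψ 0))) := by
  rw [mulOp_sub_const Γ hΓ, mulOp_sub_const Ψ hΨ, map_sub, adjoint_constOp, ← constOp_comp_constOp]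
  simp only [sub_comp, comp_sub]
  abel

lemma constOp_neg (A : E →L[ℂ] E) : constOp (-A) = -constOp A := by
  refine ContinuousLinearMap.ext fun f => ?_
  rw [neg_apply, eq_neg_iff_add_eq_zero]
  refine toFun_injective _ _ fun z hz => ?_
  rw [toFun_add _ _ hz, constOp_toFun _ _ hz, constOp_toFun _ _ hz, neg_apply, neg_add_cancel]
  simp [Hardy.toFun]

/-- The right-hand side of the product formula is a Toeplitz operator. -/
lemma isToeplitz_add_sub_constOp (Γ Ψ : ℂ → F →L[ℂ] E) (hΓ : IsBoundedAnalytic Γ)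
    (hΨ : IsBoundedAnalytic Ψ) (A B : F →L[ℂ] E) (D : E →L[ℂ] E) :
    IsToeplitz (mulOp Γ hΓ ∘L constOp (adjoint A) + constOp B ∘L adjoint (mulOp Ψ hΨ)
      - constOp D) := by
  rw [mulOp_comp_constOp, constOp_comp_adjoint_mulOp, sub_eq_add_neg, ← constOp_neg]
  exact ((isToeplitz_mulOp _ _).add (isToeplitz_adjoint_mulOp _ _)).add (isToeplitz_mulOp _ _)

end HardyToeplitz

end

/-! ### The equivalence -/

open HardyToeplitz

theorem theorem1p3 {E F : Type*}
    [NormedAddCommGroup E] [InnerProductSpace ℂ E] [CompleteSpace E]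
    [NormedAddCommGroup F] [InnerProductSpace ℂ F] [CompleteSpace F]
    (Γ Ψ : ℂ → F →L[ℂ] E) (hΓ : IsBoundedAnalytic Γ) (hΨ : IsBoundedAnalytic Ψ) :
    List.TFAE [
      IsToeplitz (mulOp Γ hΓ ∘L ContinuousLinearMap.adjoint (mulOp Ψ hΨ)),
      ∀ z ∈ Metric.ball (0 : ℂ) 1, ∀ w ∈ Metric.ball (0 : ℂ) 1,
        (Γ z - Γ 0) ∘L ContinuousLinearMap.adjoint (Ψ w - Ψ 0) = 0,
      mulOp Γ hΓ ∘L ContinuousLinearMap.adjoint (mulOp Ψ hΨ)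
        = mulOp Γ hΓ ∘L constOp (ContinuousLinearMap.adjoint (Ψ 0))
          + constOp (Γ 0) ∘L ContinuousLinearMap.adjoint (mulOp Ψ hΨ)
          - constOp (Γ 0 ∘L ContinuousLinearMap.adjoint (Ψ 0))] := by
  have hR := mulOp_sub_const_comp_adjoint Γ Ψ hΓ hΨ
  have hS := isToeplitz_add_sub_constOp Γ Ψ hΓ hΨ (Ψ 0) (Γ 0)
    (Γ 0 ∘L ContinuousLinearMap.adjoint (Ψ 0))
  have h2 := mulOp_comp_adjoint_mulOp_eq_zero_iff _ _ (hΓ.sub_const (Γ 0)) (hΨ.sub_const (Ψ 0))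
  tfae_have 2 ↔ 3 := by
    rw [← h2, hR, sub_eq_zero]
  tfae_have 3 → 1 := by
    intro h
    rw [h]
    exact hS
  tfae_have 1 → 2 := by
    intro h
    -- The defect is a difference of Toeplitz operators. Its first column vanishes because `Ψ - Ψ 0`
    -- is zero at the origin, its first row because `Γ - Γ 0` is.
    refine h2.1 (HardyToeplitz.HasConstantDiagonals.eq_zero ?_ (fun x => ?_) fun x => ?_)
    · rw [hR]
      exact h.hasConstantDiagonals.sub hS.hasConstantDiagonals
    · rw [ContinuousLinearMap.comp_apply, adjoint_mulOp_monomial_zero _ _ (sub_self _), map_zero]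
    · rw [ContinuousLinearMap.adjoint_comp, ContinuousLinearMap.adjoint_adjoint,
        ContinuousLinearMap.comp_apply, adjoint_mulOp_monomial_zero _ _ (sub_self _), map_zero]
  tfae_finish
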